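/- Let $\kappa$ be a weakly compact cardinal, where $\kappa=\omega$ is allowed. A category is called $\kappa$-coherent if it has $\kappa$-small limits (i.e. limits of diagrams with fewer than $\kappa$ arrows), pullback-stable factorizations of arrows into an effective epimorphism followed by a monomorphism, and pullback-stable unions of $\kappa$-small families of subobjects, and if transfinite cocompositions of height $<\kappa$ of $\kappa$-small effective epimorphic families are effective epimorphic. A functor is $\kappa$-coherent if it preserves $\kappa$-small limits, effective epimorphisms and $\kappa$-small unions of subobjects. A Boolean algebra is $\kappa$-coherent if it is so when it is regarded as a category. Let $B$ be a $\kappa$-coherent Boolean algebra, and let $\mathcal C$ be a small $\kappa$-coherent category which has $\kappa$-small coproducts, all of them disjoint. Let $\mathrm{Sh}(B,\tau_{\kappa\text{-}coh})$ be the topos of sheaves of sets on $B$ for the topology whose covers are the $\kappa$-small unions, and let $M:\mathcal C\to \mathrm{Sh}(B,\tau_{\kappa\text{-}coh})$ be a $\kappa$-coherent functor. Write $\Gamma M:\mathcal C\to\mathbf{Set}$, $x\mapsto (Mx)(\top)$, for its composite with the global sections functor, and let $$L^1(\Gamma M)=\operatorname{colim}\Big(\big(\textstyle\int \Gamma M\big)^{op}\to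 \mathcal C^{op}\xrightarrow{\ \mathrm{Sub}_{\mathcal C}\ }\mathbf{DLat}\Big)$$ be the colimit, in the category of bounded distributive lattices, of the subobject lattices $\mathrm{Sub}_{\mathcal C}(x)$ over all pairs $(x,a)$ with $x\in\mathcal C$ and $a\in \Gamma M(x)$; the transition maps are given by pullback of subobjects. Call $M$ strongly positively closed if for every monomorphism $u\hookrightarrow x$ in $\mathcal C$ $$Mx = Mu\ \cup\bigcup_{v\hookrightarrow x,\ v\cap u=\emptyset} Mv$$ as subobjects of $Mx$, where $\emptyset$ is the initial object of $\mathcal C$. Theorem. The following are equivalent: 1. $M$ is strongly positively closed; 2. $L^1(\Gamma M)$ is a Boolean algebra; 3. $L^1(\Gamma M)$ is isomorphic to $B$ (as a lattice). -/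

import Mathlib

open CategoryTheory Limits Opposite Cardinal

universe w v₂ u₂ v u

namespace KCoh

/-! ### Weakly compact cardinals -/

/-- Weakly compact cardinals, through the partition relation `κ → (κ)²₂`. By Ramsey's theorem
`ℵ₀` satisfies it; it is allowed as a value of `κ`. -/
def IsWeaklyCompact (κ : Cardinal.{u}) : Prop :=
  ℵ₀ ≤ κ ∧ ∀ (X : Type u), #X = κ → ∀ c : Sym2 X → Bool,
    ∃ (H : Set X) (b : Bool), #H = κ ∧ ∀ x ∈ H, ∀ y ∈ H, x ≠ y → c s(x, y) = b

/-! ### Coherent and `κ`-coherent categories -/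

section Categories

variable (κ : Cardinal.{w}) (C : Type u) [Category.{v} C]

/-- `κ`-small families of subobjects have unions, and these are stable under pullback. -/
def HasStableUnions [HasPullbacks C] : Prop :=
  ∀ ⦃X : C⦄ (ι : Type w), #ι < κ → ∀ U : ι → Subobject X,
    ∃ S : Subobject X, IsLUB (Set.range U) S ∧
      ∀ ⦃Y : C⦄ (f : Y ⟶ X),
        IsLUB (Set.range fun i => (Subobject.pullback f).obj (U i)) ((Subobject.pullback f).obj S)

/-- Coherent categories: regular categories with pullback-stable finite unions. -/
class IsCoherent : Prop extends Regular C where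
  hasStableUnions : HasStableUnions (ℵ₀ : Cardinal.{0}) C

/-- The restriction of `D : Tᵒᵖ ⥤ C` to a subset of the poset `T`. -/
abbrev restrictDiagram {C : Type u} [Category.{v} C] {T : Type w} [PartialOrder T] (D : Tᵒᵖ ⥤ C)
    (p : T → Prop) : {s : T // p s}ᵒᵖ ⥤ C :=
  (Subtype.mono_coe p).functor.op ⋙ D

/-- The cone over the restriction of `D : Tᵒᵖ ⥤ C` to the elements below `t`, with apex `D t`. -/
def coneBelow {C : Type u} [Category.{v} C] {T : Type w} [PartialOrder T] (D : Tᵒᵖ ⥤ C) (t : T) :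
    Cone (restrictDiagram D (· < t)) where
  pt := D.obj (op t)
  π :=
    { app := fun s => D.map (homOfLE s.unop.2.le).op
      naturality := fun s s' f => by
        dsimp
        rw [Category.id_comp, ← D.map_comp]
        rfl }

/-- Transfinite cocompositions of height `< κ` of `κ`-small effective epimorphic families are
effective epimorphic. The families are arranged along a rooted tree `T` of height `< κ`: the
maps from the immediate successors of a non-maximal node form a `κ`-small effective epimorphic
family, and at limit levels the diagram is continuous. The cocomposition consists of the maps to
the root from the limits along the branches of `T`. -/
def TransfiniteTransitivity : Prop :=
  ∀ (T : Type w) [PartialOrder T] [OrderBot T] (D : Tᵒᵖ ⥤ C),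
    (∃ γ : Ordinal.{w}, γ < κ.ord ∧
      ∀ t : T, ∃ _ : IsWellOrder (Set.Iio t) (· < ·),
        Ordinal.type (fun a b : Set.Iio t => a < b) < γ) →
    (∀ t : T, ¬ IsMax t → #{s : T // t ⋖ s} < κ ∧
      EffectiveEpiFamily (fun s : {s : T // t ⋖ s} => D.obj (op s.1))
        (fun s => D.map (homOfLE s.2.le).op)) →
    (∀ t : T, Order.IsSuccLimit t → Nonempty (IsLimit (coneBelow D t))) →
    ∀ c : ∀ b : Flag T, LimitCone (restrictDiagram D (· ∈ b)),
      EffectiveEpiFamily (B := D.obj (op ⊥)) (fun b : Flag T => (c b).cone.pt)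
        (fun b => (c b).cone.π.app (op ⟨⊥, b.bot_mem⟩))

/-- `κ`-coherent categories: they have `κ`-small limits, pullback-stable effective epi - mono
factorizations, pullback-stable `κ`-small unions, and `κ`-small effective epimorphic families are
closed under transfinite cocomposition of height `< κ`. -/
class IsKCoherent : Prop extends Regular C where
  hasLimitsOfShape : ∀ (J : Type w) [SmallCategory J], HasCardinalLT (Arrow J) κ →
    HasLimitsOfShape J C
  hasStableUnions : HasStableUnions κ C
  transfiniteTransitivity : TransfiniteTransitivity κ C

/-- `κ`-small coproducts exist and are disjoint. -/
def HasSmallDisjointCoproducts : Prop :=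
  ∀ ι : Type w, #ι < κ → HasCoproductsOfShape ι C ∧ CoproductsOfShapeDisjoint C ι

variable {κ C}

theorem IsKCoherent.isCoherent (hC : IsKCoherent κ C) (hκ : ℵ₀ ≤ κ) : IsCoherent C where
  hasStableUnions X ι hι U := by
    have h : #(ULift.{w} ι) < κ := by
      refine lt_of_lt_of_le ?_ hκ
      rw [mk_uLift, lift_lt_aleph0]
      exact hι
    obtain ⟨S, h1, h2⟩ := hC.hasStableUnions (ULift.{w} ι) h (fun i => U i.down)
    have e : ∀ {Z : C} (g : ι → Subobject Z),
        Set.range (fun i : ULift.{w} ι => g i.down) = Set.range g :=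
      fun g => ULift.down_surjective.range_comp g
    refine ⟨S, ?_, fun Y f => ?_⟩
    · rw [← e]; exact h1
    · rw [← e]; exact h2 f

end Categories

/-! ### `κ`-coherent functors -/

section Functors

variable {C : Type u} [Category.{v} C] {D : Type u₂} [Category.{v₂} D]

/-- The map `Sub(X) → Sub(M X)` induced by a mono-preserving functor `M`. -/
noncomputable def mapSub (M : C ⥤ D) [M.PreservesMonomorphisms] {X : C} (U : Subobject X) :
    Subobject (M.obj X) :=
  Subobject.mk (M.map U.arrow)

/-- `κ`-coherent functors: they preserve `κ`-small limits, effective (= regular) epimorphisms and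
`κ`-small unions. Preservation of monomorphisms follows from the first of these
for infinite `κ`; it is only listed in order to have the induced maps on subobjects. -/
class IsKCoherentFunctor (κ : Cardinal.{w}) (M : C ⥤ D) : Prop
    extends M.PreservesMonomorphisms where
  preservesLimitsOfShape : ∀ (J : Type w) [SmallCategory J], HasCardinalLT (Arrow J) κ →
    PreservesLimitsOfShape J M
  preservesRegularEpi : ∀ ⦃X Y : C⦄ (f : X ⟶ Y), IsRegularEpi f → IsRegularEpi (M.map f)
  preservesUnions : ∀ ⦃X : C⦄ (ι : Type w), #ι < κ → ∀ (U : ι → Subobject X) (S : Subobject X),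
    IsLUB (Set.range U) S → IsLUB (Set.range fun i => mapSub M (U i)) (mapSub M S)

theorem IsKCoherentFunctor.preservesFiniteLimits {κ : Cardinal.{w}} {M : C ⥤ D}
    (hM : IsKCoherentFunctor κ M) (hκ : ℵ₀ ≤ κ) : PreservesFiniteLimits M where
  preservesFiniteLimits J _ _ := by
    let J' := ULiftHom.{w} (ULift.{w} J)
    let e : J ≌ J' := ULiftHomULiftCategory.equiv.{w, w} J
    have : PreservesLimitsOfShape J' M :=
      hM.preservesLimitsOfShape J'
        (((hasCardinalLT_aleph0_iff (Arrow J')).2 inferInstance).of_le hκ)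
    exact preservesLimitsOfShape_of_equiv e.symm M

end Functors

/-! ### The Lindenbaum-Tarski lattice of closed formulas with parameters -/

section Subobjects

variable {C : Type u} [Category.{v} C]

theorem exists_sup [IsCoherent C] {X : C} (U V : Subobject X) :
    ∃ S : Subobject X, IsLUB {U, V} S ∧ ∀ ⦃Y : C⦄ (f : Y ⟶ X),
      IsLUB {(Subobject.pullback f).obj U, (Subobject.pullback f).obj V}
        ((Subobject.pullback f).obj S) := by
  obtain ⟨S, h1, h2⟩ := IsCoherent.hasStableUnions (C := C) (X := X) Bool
    (by simp) (fun b => cond b U V)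
  have e : ∀ {Z : C} (g : Bool → Subobject Z), Set.range g = {g true, g false} := fun g => by
    ext z; simp [or_comm]
  rw [e] at h1
  refine ⟨S, h1, fun Y f => ?_⟩
  have := h2 f
  rwa [e] at this

theorem exists_bot [IsCoherent C] (X : C) :
    ∃ S : Subobject X, ∀ ⦃Y : C⦄ (f : Y ⟶ X), IsBot ((Subobject.pullback f).obj S) := by
  obtain ⟨S, -, h2⟩ := IsCoherent.hasStableUnions (C := C) (X := X) Empty (by simp [aleph0_pos]) Empty.elim
  refine ⟨S, fun Y f => ?_⟩
  have := h2 f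
  rw [Set.range_eq_empty, isLUB_empty_iff] at this
  exact this

theorem le_of_inf_le [HasPullbacks C] {X : C} {A S T : Subobject X} :
    A ⊓ S ≤ T ↔ (Subobject.pullback A.arrow).obj S ≤ (Subobject.pullback A.arrow).obj T := by
  rw [Subobject.inf_eq_map_pullback]
  exact ⟨fun h => ((Subobject.mapPullbackAdj A.arrow).homEquiv _ _ h.hom).le,
    fun h => (((Subobject.mapPullbackAdj A.arrow).homEquiv _ _).symm h.hom).le⟩

/-- In a coherent category the subobjects of `X` form a distributive lattice, for the
usual ordering. -/
noncomputable abbrev subobjectDistribLattice [IsCoherent C] (X : C) :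
    DistribLattice (Subobject X) :=
  letI : Lattice (Subobject X) :=
    { (inferInstance : SemilatticeInf (Subobject X)) with
      sup := fun U V => (exists_sup U V).choose
      le_sup_left := fun U V => (exists_sup U V).choose_spec.1.1 (by simp)
      le_sup_right := fun U V => (exists_sup U V).choose_spec.1.1 (by simp)
      sup_le := fun U V W h h' => (exists_sup U V).choose_spec.1.2 (by simp [h, h']) }
  DistribLattice.ofInfSupLe fun A S T => by
    rw [le_of_inf_le]
    refine ((exists_sup S T).choose_spec.2 A.arrow).2 ?_
    rintro _ (rfl | rfl)
    · exact le_of_inf_le.1 le_sup_left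
    · exact le_of_inf_le.1 le_sup_right

end Subobjects

section Lindenbaum

variable {C : Type u} [Category.{v} C]

/-- A closed formula with parameters from `F : C ⥤ Type w`: a subobject `U` of an object `X`
together with an element of `F X`. -/
structure Formula (F : C ⥤ Type w) where
  obj : C
  param : F.obj obj
  sub : Subobject obj

namespace Formula

variable [HasFiniteLimits C] {F : C ⥤ Type w}

/-- `(U ↪ X, a) ≤ (V ↪ Y, b)` if the pullbacks of `U` and `V` to some common refinement of
`(X, a)` and `(Y, b)` in the category of elements of `F` satisfy `U ≤ V`. -/
def Le (p q : Formula F) : Prop :=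
  ∃ (Z : C) (c : F.obj Z) (f : Z ⟶ p.obj) (g : Z ⟶ q.obj), F.map f c = p.param ∧
    F.map g c = q.param ∧ (Subobject.pullback f).obj p.sub ≤ (Subobject.pullback g).obj q.sub

variable [PreservesFiniteLimits F]

theorem exists_pullback {X Y Z : C} (f : X ⟶ Z) (g : Y ⟶ Z) (a : F.obj X) (b : F.obj Y)
    (h : F.map f a = F.map g b) :
    ∃ (W : C) (c : F.obj W) (p : W ⟶ X) (q : W ⟶ Y), F.map p c = a ∧ F.map q c = b ∧
      p ≫ f = q ≫ g := by
  obtain ⟨c, h1, h2⟩ := Types.exists_of_isPullback ((IsPullback.of_hasPullback f g).map F) a b h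
  exact ⟨_, c, _, _, h1, h2, pullback.condition⟩

theorem subsingleton_terminal (a b : F.obj (⊤_ C)) : a = b := by
  have h := IsTerminal.isTerminalObj F _ (terminalIsTerminal (C := C))
  have := h.hom_ext (TypeCat.ofHom fun _ : PUnit => a) (TypeCat.ofHom fun _ : PUnit => b)
  exact congrArg (fun k => k PUnit.unit) this

theorem exists_terminal : Nonempty (F.obj (⊤_ C)) := by
  have h := IsTerminal.isTerminalObj F _ (terminalIsTerminal (C := C))
  exact ⟨h.from PUnit PUnit.unit⟩

theorem exists_prod (X Y : C) (a : F.obj X) (b : F.obj Y) :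
    ∃ (W : C) (c : F.obj W) (p : W ⟶ X) (q : W ⟶ Y), F.map p c = a ∧ F.map q c = b := by
  obtain ⟨W, c, p, q, h1, h2, -⟩ := exists_pullback (terminal.from X) (terminal.from Y) a b
    (subsingleton_terminal _ _)
  exact ⟨W, c, p, q, h1, h2⟩

theorem exists_equalizer {X Y : C} (f g : X ⟶ Y) (a : F.obj X) (h : F.map f a = F.map g a) :
    ∃ (W : C) (c : F.obj W) (p : W ⟶ X), F.map p c = a ∧ p ≫ f = p ≫ g := by
  obtain ⟨c, hc, -⟩ := Types.unique_of_type_equalizer _ _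
    (isLimitForkMapOfIsLimit F (equalizer.condition f g) (equalizerIsEqualizer f g)) a h
  exact ⟨_, c, _, hc, equalizer.condition f g⟩

instance : Preorder (Formula F) where
  le := Le
  le_refl p := ⟨p.obj, p.param, 𝟙 _, 𝟙 _, by simp, by simp, le_rfl⟩
  le_trans := by
    rintro p q r ⟨Z, c, f, g, h1, h2, h3⟩ ⟨Z', c', f', g', h1', h2', h3'⟩
    obtain ⟨W, d, k, k', hk, hk', e⟩ := exists_pullback g f' c c' (h2.trans h1'.symm)
    refine ⟨W, d, k ≫ f, k' ≫ g', by simp [hk, h1], by simp [hk', h2'], ?_⟩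
    rw [Subobject.pullback_comp, Subobject.pullback_comp]
    refine ((Subobject.pullback k).monotone h3).trans ?_
    rw [← Subobject.pullback_comp, e, Subobject.pullback_comp]
    exact (Subobject.pullback k').monotone h3'

end Formula

/-- `L¹(F)`, the colimit of the distributive lattices `Sub(X)` over `(X, a) ∈ (∫ F)ᵒᵖ`, i.e. the
value at `F` of the left Kan extension of `Sub` along the Yoneda embedding. As `F` preserves finite
limits, the colimit is filtered: its elements are the classes `[U ↪ X ^ a]`. -/
def L1 [HasFiniteLimits C] (F : C ⥤ Type w) [PreservesFiniteLimits F] : Type _ :=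
  Antisymmetrization (Formula F) (· ≤ ·)

namespace L1

section Order

variable [HasFiniteLimits C] {F : C ⥤ Type w} [PreservesFiniteLimits F]

instance : PartialOrder (L1 F) :=
  inferInstanceAs (PartialOrder (Antisymmetrization (Formula F) (· ≤ ·)))

/-- The class `[U ↪ X ^ a]` in `L¹(F)`. -/
def mk {X : C} (a : F.obj X) (U : Subobject X) : L1 F :=
  toAntisymmetrization (· ≤ ·) (⟨X, a, U⟩ : Formula F)

theorem mk_le_mk {X Y : C} {a : F.obj X} {b : F.obj Y} {U : Subobject X} {V : Subobject Y} :
    mk a U ≤ mk b V ↔ ∃ (Z : C) (c : F.obj Z) (f : Z ⟶ X) (g : Z ⟶ Y), F.map f c = a ∧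
      F.map g c = b ∧ (Subobject.pullback f).obj U ≤ (Subobject.pullback g).obj V :=
  Iff.rfl

theorem ind (t : L1 F) : ∃ (X : C) (a : F.obj X) (U : Subobject X), t = mk a U := by
  induction t using Quotient.inductionOn with
  | h p => exact ⟨p.obj, p.param, p.sub, rfl⟩

theorem mk_pullback {X Y : C} (f : X ⟶ Y) (a : F.obj X) (U : Subobject Y) :
    mk a ((Subobject.pullback f).obj U) = mk (F.map f a) U := by
  apply le_antisymm
  · exact mk_le_mk.2 ⟨X, a, 𝟙 X, f, by simp, rfl, by rw [Subobject.pullback_id]⟩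
  · exact mk_le_mk.2 ⟨X, a, f, 𝟙 X, rfl, by simp, by rw [Subobject.pullback_id]⟩

theorem mk_mono {X : C} (a : F.obj X) {U V : Subobject X} (h : U ≤ V) : mk a U ≤ mk a V :=
  mk_le_mk.2 ⟨X, a, 𝟙 X, 𝟙 X, by simp, by simp, (Subobject.pullback (𝟙 X)).monotone h⟩

theorem mk_le_mk_iff {X : C} {a : F.obj X} {U V : Subobject X} :
    mk a U ≤ mk a V ↔ ∃ (Z : C) (c : F.obj Z) (f : Z ⟶ X), F.map f c = a ∧
      (Subobject.pullback f).obj U ≤ (Subobject.pullback f).obj V := by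
  rw [mk_le_mk]
  constructor
  · rintro ⟨Z, c, f, g, h1, h2, h3⟩
    obtain ⟨W, d, p, hp, e⟩ := Formula.exists_equalizer f g c (h1.trans h2.symm)
    refine ⟨W, d, p ≫ f, by simp [hp, h1], ?_⟩
    rw [Subobject.pullback_comp]
    refine ((Subobject.pullback p).monotone h3).trans (le_of_eq ?_)
    rw [← Subobject.pullback_comp, e]
  · rintro ⟨Z, c, f, h1, h2⟩
    exact ⟨Z, c, f, f, h1, h1, h2⟩

theorem exists_common (s t : L1 F) :
    ∃ (X : C) (a : F.obj X) (U V : Subobject X), s = mk a U ∧ t = mk a V := by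
  obtain ⟨X, a, U, rfl⟩ := ind s
  obtain ⟨Y, b, V, rfl⟩ := ind t
  obtain ⟨W, c, p, q, rfl, rfl⟩ := Formula.exists_prod X Y a b
  exact ⟨W, c, _, _, (mk_pullback p c U).symm, (mk_pullback q c V).symm⟩

theorem exists_common₃ (r s t : L1 F) :
    ∃ (X : C) (a : F.obj X) (U V W : Subobject X), r = mk a U ∧ s = mk a V ∧ t = mk a W := by
  obtain ⟨X, a, U, V, rfl, rfl⟩ := exists_common r s
  obtain ⟨Y, b, W, rfl⟩ := ind t
  obtain ⟨Z, c, p, q, rfl, rfl⟩ := Formula.exists_prod X Y a b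
  exact ⟨Z, c, _, _, _, (mk_pullback p c U).symm, (mk_pullback p c V).symm,
    (mk_pullback q c W).symm⟩

/-- Any two refinements of `(X, a)` have a common refinement. -/
theorem exists_refinement {X Y Z : C} {a : F.obj X} (f : Y ⟶ X) (b : F.obj Y) (hb : F.map f b = a)
    (g : Z ⟶ X) (c : F.obj Z) (hc : F.map g c = a) :
    ∃ (W : C) (d : F.obj W) (p : W ⟶ Y) (q : W ⟶ Z), F.map (p ≫ f) d = a ∧ p ≫ f = q ≫ g := by
  obtain ⟨W, d, p, q, h1, -, e⟩ := Formula.exists_pullback f g b c (hb.trans hc.symm)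
  exact ⟨W, d, p, q, by simp [h1, hb], e⟩

theorem isGLB_mk {X : C} (a : F.obj X) (U V : Subobject X) :
    IsGLB {mk a U, mk a V} (mk a (U ⊓ V)) := by
  refine ⟨?_, fun t ht => ?_⟩
  · rintro _ (rfl | rfl)
    · exact mk_mono a inf_le_left
    · exact mk_mono a inf_le_right
  · obtain ⟨Y, b, T, rfl⟩ := ind t
    obtain ⟨Z, c, p, q, rfl, rfl⟩ := Formula.exists_prod X Y a b
    have h1 : mk (F.map q c) T ≤ mk (F.map p c) U := ht (by simp)
    have h2 : mk (F.map q c) T ≤ mk (F.map p c) V := ht (by simp)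
    rw [← mk_pullback, ← mk_pullback, mk_le_mk_iff] at h1 h2
    rw [← mk_pullback, ← mk_pullback, mk_le_mk_iff]
    obtain ⟨Z₁, c₁, f₁, e₁, h1⟩ := h1
    obtain ⟨Z₂, c₂, f₂, e₂, h2⟩ := h2
    obtain ⟨W, d, k₁, k₂, e, e'⟩ := exists_refinement f₁ c₁ e₁ f₂ c₂ e₂
    refine ⟨W, d, k₁ ≫ f₁, e, ?_⟩
    rw [Subobject.inf_pullback, Subobject.inf_pullback]
    apply le_inf
    · simpa only [Subobject.pullback_comp] using (Subobject.pullback k₁).monotone h1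
    · rw [e']
      simpa only [Subobject.pullback_comp] using (Subobject.pullback k₂).monotone h2

theorem isTop_mk {X : C} (a : F.obj X) : IsTop (mk a (⊤ : Subobject X)) := fun t => by
  obtain ⟨Y, b, T, rfl⟩ := ind t
  obtain ⟨Z, c, p, q, rfl, rfl⟩ := Formula.exists_prod X Y a b
  exact mk_le_mk.2 ⟨Z, c, q, p, rfl, rfl, by rw [Subobject.pullback_top]; exact le_top⟩

end Order

section Lattice

variable [IsCoherent C] {F : C ⥤ Type w} [PreservesFiniteLimits F]

theorem isLUB_mk {X : C} (a : F.obj X) {U V S : Subobject X} (hS : IsLUB {U, V} S) :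
    IsLUB {mk a U, mk a V} (mk a S) := by
  obtain ⟨S', hS', hst⟩ := exists_sup U V
  obtain rfl := hS.unique hS'
  refine ⟨?_, fun t ht => ?_⟩
  · rintro _ (rfl | rfl)
    · exact mk_mono a (hS.1 (by simp))
    · exact mk_mono a (hS.1 (by simp))
  · obtain ⟨Y, b, T, rfl⟩ := ind t
    obtain ⟨Z, c, p, q, rfl, rfl⟩ := Formula.exists_prod X Y a b
    have h1 : mk (F.map p c) U ≤ mk (F.map q c) T := ht (by simp)
    have h2 : mk (F.map p c) V ≤ mk (F.map q c) T := ht (by simp)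
    rw [← mk_pullback, ← mk_pullback, mk_le_mk_iff] at h1 h2
    rw [← mk_pullback, ← mk_pullback, mk_le_mk_iff]
    obtain ⟨Z₁, c₁, f₁, e₁, h1⟩ := h1
    obtain ⟨Z₂, c₂, f₂, e₂, h2⟩ := h2
    obtain ⟨W, d, k₁, k₂, e, e'⟩ := exists_refinement f₁ c₁ e₁ f₂ c₂ e₂
    refine ⟨W, d, k₁ ≫ f₁, e, ?_⟩
    rw [← Subobject.pullback_comp]
    refine (hst _).2 ?_
    rintro _ (rfl | rfl)
    · simpa only [Subobject.pullback_comp] using (Subobject.pullback k₁).monotone h1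
    · rw [e']
      simpa only [Subobject.pullback_comp] using (Subobject.pullback k₂).monotone h2

theorem isBot_mk {X : C} (a : F.obj X) {S : Subobject X} (hS : IsBot S) : IsBot (mk a S) :=
  fun t => by
    obtain ⟨S', hS'⟩ := exists_bot X
    have h0 : S' = S := by
      apply le_antisymm _ (hS S')
      have := hS' (𝟙 X) S
      rwa [Subobject.pullback_id] at this
    subst h0
    obtain ⟨Y, b, T, rfl⟩ := ind t
    obtain ⟨Z, c, p, q, rfl, rfl⟩ := Formula.exists_prod X Y a b
    exact mk_le_mk.2 ⟨Z, c, p, q, rfl, rfl, hS' p _⟩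

theorem exists_isLUB (s t : L1 F) : ∃ r, IsLUB {s, t} r := by
  obtain ⟨X, a, U, V, rfl, rfl⟩ := exists_common s t
  obtain ⟨S, hS, -⟩ := exists_sup U V
  exact ⟨_, isLUB_mk a hS⟩

theorem exists_isGLB (s t : L1 F) : ∃ r, IsGLB {s, t} r := by
  obtain ⟨X, a, U, V, rfl, rfl⟩ := exists_common s t
  exact ⟨_, isGLB_mk a U V⟩

theorem exists_isTop : ∃ t : L1 F, IsTop t :=
  ⟨_, isTop_mk (Formula.exists_terminal (F := F)).some⟩

theorem exists_isBot : ∃ t : L1 F, IsBot t := by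
  obtain ⟨S, hS⟩ := exists_bot (⊤_ C)
  have h := hS (𝟙 _)
  rw [Subobject.pullback_id] at h
  exact ⟨_, isBot_mk (Formula.exists_terminal (F := F)).some h⟩

noncomputable instance : Lattice (L1 F) where
  sup s t := (exists_isLUB s t).choose
  le_sup_left s t := (exists_isLUB s t).choose_spec.1 (by simp)
  le_sup_right s t := (exists_isLUB s t).choose_spec.1 (by simp)
  sup_le s t r h h' := (exists_isLUB s t).choose_spec.2 (by simp [h, h'])
  inf s t := (exists_isGLB s t).choose
  inf_le_left s t := (exists_isGLB s t).choose_spec.1 (by simp)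
  inf_le_right s t := (exists_isGLB s t).choose_spec.1 (by simp)
  le_inf s t r h h' := (exists_isGLB t r).choose_spec.2 (by simp [h, h'])

noncomputable instance : BoundedOrder (L1 F) where
  top := exists_isTop.choose
  le_top := exists_isTop.choose_spec
  bot := exists_isBot.choose
  bot_le := exists_isBot.choose_spec

theorem mk_inf {X : C} (a : F.obj X) (U V : Subobject X) : mk a (U ⊓ V) = mk a U ⊓ mk a V :=
  (isGLB_mk a U V).unique isGLB_pair

theorem mk_sup {X : C} (a : F.obj X) (U V : Subobject X) :
    mk a ((subobjectDistribLattice X).sup U V) = mk a U ⊔ mk a V :=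
  (isLUB_mk a (exists_sup U V).choose_spec.1).unique isLUB_pair

/-- The distributive lattice structure on `L¹(F)`. The maps `mk a : Sub(X) → L¹(F)` form a
cocone of bounded distributive lattices, and `existsUnique_desc` is its universal property. -/
noncomputable instance : DistribLattice (L1 F) :=
  DistribLattice.ofInfSupLe fun r s t => by
    obtain ⟨X, a, U, V, W, rfl, rfl, rfl⟩ := exists_common₃ r s t
    rw [← mk_sup, ← mk_inf, ← mk_inf, ← mk_inf, ← mk_sup]
    exact mk_mono a (le_of_eq (@inf_sup_left _ (subobjectDistribLattice X) U V W))

/-- `L¹(F)` is the colimit of the lattices `Sub(X)` over the category of elements of `F`. -/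
theorem existsUnique_desc {P : Type*} [DistribLattice P] [BoundedOrder P]
    (φ : ∀ ⦃X : C⦄, F.obj X → Subobject X → P)
    (hsup : ∀ ⦃X : C⦄ (a : F.obj X) (U V : Subobject X),
      φ a ((subobjectDistribLattice X).sup U V) = φ a U ⊔ φ a V)
    (hinf : ∀ ⦃X : C⦄ (a : F.obj X) (U V : Subobject X), φ a (U ⊓ V) = φ a U ⊓ φ a V)
    (htop : ∀ ⦃X : C⦄ (a : F.obj X), φ a ⊤ = ⊤)
    (hbot : ∀ ⦃X : C⦄ (a : F.obj X) (S : Subobject X), IsBot S → φ a S = ⊥)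
    (hnat : ∀ ⦃X Y : C⦄ (f : X ⟶ Y) (a : F.obj X) (U : Subobject Y),
      φ a ((Subobject.pullback f).obj U) = φ (F.map f a) U) :
    ∃! ψ : BoundedLatticeHom (L1 F) P, ∀ ⦃X : C⦄ (a : F.obj X) (U : Subobject X),
      ψ (mk a U) = φ a U := by
  have hmono : ∀ ⦃X : C⦄ (a : F.obj X) {U V : Subobject X}, U ≤ V → φ a U ≤ φ a V :=
    fun X a U V h => by rw [← inf_eq_left.2 h, hinf]; exact inf_le_right
  have hle : ∀ p q : Formula F, p ≤ q → φ p.param p.sub ≤ φ q.param q.sub := by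
    rintro p q ⟨Z, c, f, g, h1, h2, h3⟩
    rw [← h1, ← h2, ← hnat, ← hnat]
    exact hmono c h3
  let ψ : L1 F → P := Quotient.lift (fun p : Formula F => φ p.param p.sub)
    fun p q h => le_antisymm (hle p q h.1) (hle q p h.2)
  have hψ : ∀ ⦃X : C⦄ (a : F.obj X) (U : Subobject X), ψ (mk a U) = φ a U := fun _ _ _ => rfl
  refine ⟨{ toFun := ψ, map_sup' := ?_, map_inf' := ?_, map_top' := ?_, map_bot' := ?_ },
    hψ, fun χ hχ => ?_⟩
  · intro s t
    obtain ⟨X, a, U, V, rfl, rfl⟩ := exists_common s t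
    rw [← mk_sup, hψ, hψ, hψ, hsup]
  · intro s t
    obtain ⟨X, a, U, V, rfl, rfl⟩ := exists_common s t
    rw [← mk_inf, hψ, hψ, hψ, hinf]
  · obtain ⟨a⟩ := Formula.exists_terminal (F := F)
    have h : mk a ⊤ = (⊤ : L1 F) := isTop_iff_eq_top.1 (isTop_mk a)
    rw [← h]
    exact (hψ a _).trans (htop a)
  · obtain ⟨a⟩ := Formula.exists_terminal (F := F)
    obtain ⟨S, hS⟩ := exists_bot (⊤_ C)
    have hb := hS (𝟙 _)
    rw [Subobject.pullback_id] at hb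
    have h : mk a S = (⊥ : L1 F) := isBot_iff_eq_bot.1 (isBot_mk a hb)
    rw [← h]
    exact (hψ a _).trans (hbot a S hb)
  · ext t
    obtain ⟨X, a, U, rfl⟩ := ind t
    exact hχ a U

end Lattice

end L1

end Lindenbaum

/-! ### `Sh(B)`-valued models -/

section Models

/-- The covering families on `B` generating `τ_{κ-coh}`: `κ`-small unions. -/
def unionPrecoverage (κ : Cardinal.{u}) (B : Type u) [Preorder B] : Precoverage B where
  coverings b :=
    { R | ∃ (ι : Type u) (_ : #ι < κ) (f : ι → B) (h : IsLUB (Set.range f) b),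
      R = Presieve.ofArrows f fun i => homOfLE (h.1 (Set.mem_range_self i)) }

/-- The topology `τ_{κ-coh}` on `B`, generated by `κ`-small unions. -/
def unionTopology (κ : Cardinal.{u}) (B : Type u) [Preorder B] : GrothendieckTopology B :=
  (unionPrecoverage κ B).toGrothendieck

/-- Global sections `Γ M : C ⥤ Set` of a functor `M : C ⥤ Sh(B)`, i.e. `X ↦ (M X)(⊤)`. -/
def globalSections {C : Type u} [Category.{v} C] {B : Type w} [Preorder B] [OrderTop B]
    {J : GrothendieckTopology B} (M : C ⥤ Sheaf J (Type w)) : C ⥤ Type w :=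
  M ⋙ sheafToPresheaf J (Type w) ⋙ (evaluation Bᵒᵖ (Type w)).obj (op ⊤)

instance {C : Type u} [Category.{v} C] {B : Type w} [Preorder B] [OrderTop B]
    {J : GrothendieckTopology B} (M : C ⥤ Sheaf J (Type w)) [PreservesFiniteLimits M] :
    PreservesFiniteLimits (globalSections M) :=
  inferInstanceAs (PreservesFiniteLimits
    (M ⋙ sheafToPresheaf J (Type w) ⋙ (evaluation Bᵒᵖ (Type w)).obj (op ⊤)))

/-- `M` is strongly positively closed if for each subobject `U ↪ X` we have
`M X = M U ∪ ⋃ {M V : V ↪ X, V ∩ U = ∅}`, as subobjects of `M X`. -/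
def IsStronglyPositivelyClosed {C : Type u} [Category.{v} C] [HasPullbacks C]
    {D : Type u₂} [Category.{v₂} D] (M : C ⥤ D) [M.PreservesMonomorphisms] : Prop :=
  ∀ ⦃X : C⦄ (U : Subobject X),
    IsLUB ({mapSub M U} ∪
      {W | ∃ V : Subobject X, Nonempty (IsInitial ((V ⊓ U : Subobject X) : C)) ∧ W = mapSub M V}) ⊤

end Models

end KCoh

/-!
Every closed formula with parameters, i.e. a subobject `U ↪ X` together with a global section `a`
of `M X`, has a set of truth values (`truthSet`): the `b : B` such that `a`, restricted to `b`,
lies in `M U`. This is an ideal of `B`, and it depends only on the class of the formula in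
`L¹(Γ M)`, monotonically (`truthSet_subset_of_mk_le`).

Let `M` be strongly positively closed. Covering sieves of `τ_{κ-coh}` contain `κ`-small unions
(`exists_small_cover`; this uses the regularity of `κ`). So `⊤` is a `κ`-small union of elements
over each of which `a` satisfies `U` or a formula disjoint from `U`. As `B` is `κ`-complete and
`κ`-small unions in `C` are stable, there are one `b` and one `V` disjoint from `U` such that `U`
holds over `b` and `V` over `bᶜ` (`exists_truthValue`). Thus the ideal is principal, generated
by `b`. Sending the formula to `b` is an order embedding `L¹(Γ M) → B`, since a formula that holds
everywhere is `⊤` in `L¹(Γ M)`. It is onto since a global section of `M (1 + 1)` may be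
glued from the two points over `b` and `bᶜ`. So `L¹(Γ M) ≃o B`, and in particular `L¹(Γ M)` is
complemented.

Let `L¹(Γ M)` be complemented. A section of `M X` over `b` extends to a global section of
`M (X + 1)`. At this section, the formula `U` has a complement, which is a subobject `V` of some
`f : Z ⟶ X + 1` over which the section lifts. By Frobenius reciprocity the image of `V` along `f`
is disjoint from `U`, and the section locally lies in one of the two
(`isStronglyPositivelyClosed_of_complementedLattice`).
-/

namespace KCoh

/-! ### Regularity of weakly compact cardinals -/

/-- A weakly compact cardinal is regular: otherwise, split a set of size `κ` into fewer than `κ`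
blocks of size less than `κ` and colour a pair by whether it lies within one block. A homogeneous
set lies inside one block or meets each block at most once, so it has size less than `κ`. -/
theorem IsWeaklyCompact.mk_sigma_lt {κ : Cardinal.{u}} (hκ : IsWeaklyCompact κ) {ι : Type u}
    (hι : #ι < κ) (A : ι → Type u) (hA : ∀ i, #(A i) < κ) : #(Σ i, A i) < κ := by
  by_contra! hlt
  obtain ⟨X, hX⟩ := le_mk_iff_exists_set.1 hlt
  classical
  let c : Sym2 X → Bool := Sym2.lift
    ⟨fun x y => decide (x.1.1 = y.1.1), fun x y => by simp [eq_comm]⟩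
  obtain ⟨H, b, hH, hc⟩ := hκ.2 X hX c
  have hcp : ∀ x y : X, c s(x, y) = decide (x.1.1 = y.1.1) := fun _ _ => rfl
  cases b with
  | false =>
    refine (lt_of_le_of_lt ?_ hι).ne hH
    refine mk_le_of_injective (f := fun x : H => x.1.1.1) fun x y hxy => ?_
    by_contra hne
    have := hc x x.2 y y.2 (fun h => hne (Subtype.ext h))
    rw [hcp] at this
    simp only [decide_eq_false_iff_not] at this
    exact this hxy
  | true =>
    have hne : Nonempty H := by
      rw [← mk_ne_zero_iff, hH]
      exact (aleph0_pos.trans_le hκ.1).ne'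
    obtain ⟨x₀⟩ := hne
    have h : ∀ x : H, x.1.1.1 = x₀.1.1.1 := fun x => by
      by_cases hx : x = x₀
      · rw [hx]
      · have := hc x x.2 x₀ x₀.2 (fun h => hx (Subtype.ext h))
        rw [hcp] at this
        simpa using this
    refine (lt_of_le_of_lt ?_ (hA x₀.1.1.1)).ne hH
    refine mk_le_of_injective (f := fun x : H => h x ▸ x.1.1.2) fun x y hxy => ?_
    refine Subtype.ext (Subtype.ext (Sigma.ext ((h x).trans (h y).symm) ?_))
    dsimp only at hxy
    exact (eqRec_heq (h x) x.1.1.2).symm.trans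
      ((heq_of_eq hxy).trans (eqRec_heq (h y) y.1.1.2))

/-! ### The topology of small unions on a Boolean algebra -/

section Topology

variable {κ : Cardinal.{u}} {B : Type u} [BooleanAlgebra B]

/-- Meets distribute over all existing joins. -/
theorem isLUB_range_inf {ι : Type*} {f : ι → B} {b : B} (h : IsLUB (Set.range f) b) (c : B) :
    IsLUB (Set.range fun i => f i ⊓ c) (b ⊓ c) := by
  have := (GaloisConnection.isLUB_l_image (l := fun x => x ⊓ c) (u := fun x => c ⇨ x)
    (fun x y => le_himp_iff.symm) h)
  rwa [← Set.range_comp] at this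

/-- The covering sieves for `τ_{κ-coh}` are those containing a `κ`-small union. -/
theorem exists_small_cover (hκ : IsWeaklyCompact κ) {b : B} {S : Sieve b}
    (hS : S ∈ unionTopology κ B b) :
    ∃ (ι : Type u) (_ : #ι < κ) (f : ι → B), (∀ i, ∃ h : f i ⟶ b, S h) ∧
      IsLUB (Set.range f) b := by
  have hκ1 : (1 : Cardinal) < κ := one_lt_aleph0.trans_le hκ.1
  replace hS : (unionPrecoverage κ B).Saturate b S := hS
  induction hS with
  | of X S hS =>
    obtain ⟨ι, hι, f, h, rfl⟩ := hS
    exact ⟨ι, hι, f, fun i => ⟨_, Sieve.le_generate _ _ _ (Presieve.ofArrows.mk i)⟩, h⟩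
  | top X =>
    exact ⟨PUnit, by simpa using hκ1, fun _ => X, fun _ => ⟨𝟙 X, trivial⟩, by simp⟩
  | pullback X S hS Y g ih =>
    obtain ⟨ι, hι, f, hf, h⟩ := ih
    refine ⟨ι, hι, fun i => f i ⊓ Y, fun i => ⟨homOfLE inf_le_right, ?_⟩, ?_⟩
    · obtain ⟨k, hk⟩ := hf i
      exact S.downward_closed hk (homOfLE inf_le_left)
    · have := isLUB_range_inf h Y
      rwa [inf_eq_right.2 (leOfHom g)] at this
  | transitive X S R hS hR ih1 ih2 =>
    obtain ⟨ι, hι, f, hf, h⟩ := ih1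
    choose k hk using hf
    choose J hJ g hg hlub using fun i => ih2 (hk i)
    refine ⟨Σ i, J i, hκ.mk_sigma_lt hι J hJ, fun p => g p.1 p.2, fun p => ?_, ?_⟩
    · obtain ⟨l, hl⟩ := hg p.1 p.2
      exact ⟨l ≫ k p.1, hl⟩
    · refine ⟨?_, fun c hc => h.2 ?_⟩
      · rintro _ ⟨p, rfl⟩
        obtain ⟨l, -⟩ := hg p.1 p.2
        exact leOfHom (l ≫ k p.1)
      · rintro _ ⟨i, rfl⟩
        refine (hlub i).2 ?_
        rintro _ ⟨j, rfl⟩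
        exact hc ⟨⟨i, j⟩, rfl⟩

theorem mem_unionTopology {b : B} {S : Sieve b} {ι : Type u} (hι : #ι < κ) (f : ι → B)
    (hf : ∀ i, ∃ h : f i ⟶ b, S h) (h : IsLUB (Set.range f) b) : S ∈ unionTopology κ B b := by
  refine (unionTopology κ B).superset_covering ?_
    (Precoverage.generate_mem_toGrothendieck ⟨ι, hι, f, h, rfl⟩)
  rw [Sieve.generate_le_iff]
  rintro _ _ ⟨i⟩
  exact (hf i).choose_spec

theorem eq_bot_of_bot_mem_unionTopology (hκ : IsWeaklyCompact κ) {b : B}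
    (h : (⊥ : Sieve b) ∈ unionTopology κ B b) : b = ⊥ := by
  obtain ⟨ι, -, f, hf, hlub⟩ := exists_small_cover hκ h
  refine le_bot_iff.1 (hlub.2 ?_)
  rintro _ ⟨i, rfl⟩
  exact (hf i).choose_spec.elim

/-- Sections of a sheaf over `b` and over `bᶜ` are glued to a global section. -/
theorem exists_glue (hκ : ℵ₀ ≤ κ) (F : Sheaf (unionTopology κ B) (Type w)) (b : B)
    (x : F.obj.obj (op b)) (y : F.obj.obj (op bᶜ)) :
    ∃ s : F.obj.obj (op ⊤), F.obj.map (homOfLE le_top).op s = x ∧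
      F.obj.map (homOfLE le_top).op s = y := by
  have hF := (isSheaf_iff_isSheaf_of_type _ _).1 F.property
  let f : ULift.{u} Bool → B := fun i => cond i.down b bᶜ
  have h2 : #(ULift.{u} Bool) < κ := lt_of_lt_of_le (by simp) hκ
  have hlub : IsLUB (Set.range f) ⊤ := by
    refine ⟨fun _ _ => le_top, fun c hc => ?_⟩
    have h1 : b ≤ c := hc ⟨⟨true⟩, rfl⟩
    have h2 : bᶜ ≤ c := hc ⟨⟨false⟩, rfl⟩
    rw [← sup_compl_eq_top (x := b)]
    exact sup_le h1 h2
  have hs : Presieve.IsSheafFor F.obj (Presieve.ofArrows f fun i => homOfLE (le_top (a := f i))) :=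
    (Presieve.isSheafFor_iff_generate _).2
      (hF _ (Precoverage.generate_mem_toGrothendieck ⟨_, h2, f, hlub, rfl⟩))
  -- The least element of `B` is covered by the empty family.
  have hsub : ∀ c : B, c ≤ ⊥ → Subsingleton (F.obj.obj (op c)) := fun c hc => by
    have h0 : (⊥ : Sieve c) ∈ unionTopology κ B c :=
      mem_unionTopology (ι := PEmpty) (by simpa using aleph0_pos.trans_le hκ) PEmpty.elim
        (fun i => i.elim) (by
          rw [Set.range_eq_empty, isLUB_empty_iff, isBot_iff_eq_bot]; exact le_bot_iff.1 hc)
    exact ⟨fun s t => (hF _ h0).isSeparatedFor.ext fun _ _ h => h.elim⟩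
  rw [Presieve.isSheafFor_arrows_iff] at hs
  obtain ⟨s, hs, -⟩ := hs (fun i => match i with | ⟨true⟩ => x | ⟨false⟩ => y) (by
    rintro ⟨i⟩ ⟨j⟩ Z p q -
    cases i <;> cases j
    · rw [Subsingleton.elim p q]
    · have := hsub Z ((le_inf (leOfHom q) (leOfHom p)).trans (inf_compl_self b).le)
      exact Subsingleton.elim _ _
    · have := hsub Z ((le_inf (leOfHom p) (leOfHom q)).trans (inf_compl_self b).le)
      exact Subsingleton.elim _ _
    · rw [Subsingleton.elim p q])
  exact ⟨s, hs ⟨true⟩, hs ⟨false⟩⟩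

/-- A `κ`-coherent Boolean algebra is `κ`-complete. -/
theorem IsKCoherent.exists_isLUB_range (hB : IsKCoherent κ B) {ι : Type u} (hι : #ι < κ)
    (f : ι → B) : ∃ b, IsLUB (Set.range f) b := by
  have : HasLimitsOfShape (Discrete ι) B := hB.hasLimitsOfShape _ (by
    rw [hasCardinalLT_iff_cardinal_mk_lt]
    refine lt_of_le_of_lt (mk_le_of_injective (f := fun a : Arrow (Discrete ι) => a.left.as) ?_) hι
    rintro ⟨⟨i⟩, ⟨j⟩, ⟨⟨h⟩⟩⟩ ⟨⟨i'⟩, ⟨j'⟩, ⟨⟨h'⟩⟩⟩ (e : i = i')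
    obtain rfl : i = j := h
    obtain rfl : i' = j' := h'
    subst e
    rfl)
  refine ⟨(∏ᶜ fun i => (f i)ᶜ)ᶜ, ?_, fun c hc => ?_⟩
  · rintro _ ⟨i, rfl⟩
    exact le_compl_comm.1 (leOfHom (Pi.π (fun i => (f i)ᶜ) i))
  · refine compl_le_of_compl_le (leOfHom (Pi.lift fun i => homOfLE ?_))
    exact compl_le_compl (hc ⟨i, rfl⟩)

end Topology

/-! ### Subobjects of sheaves of sets -/

section Subsheaves

variable {D : Type u₂} [Category.{v₂} D] {J : GrothendieckTopology D} {F : Sheaf J (Type w)}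

instance {G : Sheaf J (Type w)} (f : G ⟶ F) [Mono f] : Mono f.hom :=
  inferInstanceAs (Mono ((sheafToPresheaf J (Type w)).map f))

/-- The sections of `F` that belong to the subobject `W`. -/
noncomputable def sections (W : Subobject F) : Subfunctor F.obj :=
  Subfunctor.range W.arrow.hom

/-- A subobject is isomorphic to the presheaf of its sections. -/
noncomputable def sectionsIso (W : Subobject F) :
    (W : Sheaf J (Type w)).obj ≅ (sections W).toFunctor :=
  have : Mono W.arrow.hom := inferInstance
  let e : _ ≅ (Subfunctor.range W.arrow.hom).toFunctor := asIso (Subfunctor.toRange W.arrow.hom)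
  e

theorem sectionsIso_inv_comp (W : Subobject F) :
    (sectionsIso W).inv ≫ W.arrow.hom = (sections W).ι := by
  rw [Iso.inv_comp_eq]
  rfl

theorem sections_isSheaf (W : Subobject F) : Presieve.IsSheaf J (sections W).toFunctor :=
  Presieve.isSheaf_iso J (sectionsIso W)
    ((isSheaf_iff_isSheaf_of_type _ _).1 (W : Sheaf J (Type w)).property)

theorem sections_mk {G : Sheaf J (Type w)} (f : G ⟶ F) [Mono f] :
    sections (Subobject.mk f) = Subfunctor.range f.hom := by
  apply le_antisymm
  · have h := Subobject.underlyingIso_hom_comp_eq_mk f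
    rw [sections, ← h]
    exact Subfunctor.range_comp_le _ _
  · have h := Subobject.underlyingIso_arrow f
    rw [sections]
    conv_lhs => rw [← h]
    exact Subfunctor.range_comp_le _ _

theorem sections_le_sections {W W' : Subobject F} : sections W ≤ sections W' ↔ W ≤ W' := by
  constructor
  · intro h
    let g : (W : Sheaf J (Type w)).obj ⟶ (W' : Sheaf J (Type w)).obj :=
      Subfunctor.lift W.arrow.hom h ≫ (sectionsIso W').inv
    refine Subobject.le_of_comm ⟨g⟩ ?_
    ext1
    change (Subfunctor.lift W.arrow.hom h ≫ (sectionsIso W').inv) ≫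
      W'.arrow.hom = W.arrow.hom
    rw [Category.assoc, sectionsIso_inv_comp]
    exact Subfunctor.lift_ι _ _
  · intro h
    rw [sections, ← Subobject.ofLE_arrow h]
    exact Subfunctor.range_comp_le _ _

theorem exists_sections_eq (G : Subfunctor F.obj) (hG : Presieve.IsSheaf J G.toFunctor) :
    ∃ W : Subobject F, sections W = G := by
  let G' : Sheaf J (Type w) := ⟨G.toFunctor, (isSheaf_iff_isSheaf_of_type _ _).2 hG⟩
  let i : G' ⟶ F := ⟨G.ι⟩
  have : Mono i := (sheafToPresheaf J (Type w)).mono_of_mono_map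
    (inferInstanceAs (Mono G.ι))
  exact ⟨Subobject.mk i, (sections_mk i).trans (Subfunctor.range_ι G)⟩

/-- Unions of subsheaves are computed locally. -/
theorem isLUB_iff_sections {𝒲 : Set (Subobject F)} {L : Subobject F} :
    IsLUB 𝒲 L ↔ sections L = (⨆ W ∈ 𝒲, sections W).sheafify J := by
  have hF := (isSheaf_iff_isSheaf_of_type _ _).1 F.property
  obtain ⟨L', hL'⟩ := exists_sections_eq ((⨆ W ∈ 𝒲, sections W).sheafify J)
    (Subfunctor.sheafify_isSheaf _ hF)
  have h : IsLUB 𝒲 L' := by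
    refine ⟨fun W hW => ?_, fun W hW => ?_⟩
    · rw [← sections_le_sections, hL']
      exact (le_iSup₂_of_le (f := fun W (_ : W ∈ 𝒲) => sections W) W hW le_rfl).trans (Subfunctor.le_sheafify J _)
    · rw [← sections_le_sections, hL']
      refine Subfunctor.sheafify_le _ _ (iSup₂_le fun W' hW' => ?_) hF (sections_isSheaf W)
      exact sections_le_sections.2 (hW hW')
  rw [← hL']
  constructor
  · intro hL
    rw [hL.unique h]
  · intro e
    rwa [le_antisymm (sections_le_sections.1 e.le) (sections_le_sections.1 e.ge)]

theorem mem_sections_of_isLUB {𝒲 : Set (Subobject F)} {L : Subobject F} (h : IsLUB 𝒲 L)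
    {d : D} {x : F.obj.obj (op d)} (hx : x ∈ (sections L).obj (op d)) :
    (⨆ W ∈ 𝒲, sections W).sieveOfSection x ∈ J d := by
  rw [isLUB_iff_sections.1 h] at hx
  exact hx

end Subsheaves

/-! ### Bottom subobjects and initial objects in coherent categories -/

section Coherent

variable {C : Type u} [Category.{v} C] [IsCoherent C]

theorem isBot_pullback {X Y : C} {S : Subobject X} (hS : IsBot S) (f : Y ⟶ X) :
    IsBot ((Subobject.pullback f).obj S) := by
  obtain ⟨S', hS'⟩ := exists_bot X
  have h := hS' (𝟙 X)
  rw [Subobject.pullback_id] at h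
  rw [le_antisymm (hS S') (h S)]
  exact hS' f

/-- The bottom subobject of `X` is an initial object: every object over it has only one subobject,
so parallel maps out of such an object agree, and every map between such objects is a
monomorphism, hence an isomorphism. In particular, its product with `Y` projects to it
isomorphically, which gives the map to `Y`. -/
theorem nonempty_isInitial_of_isBot {X : C} {U : Subobject X} (hU : IsBot U) :
    Nonempty (IsInitial (U : C)) := by
  have htop : ∀ {Z : C} (_ : Z ⟶ (U : C)) (V : Subobject Z), V = ⊤ := fun {Z} f V => by
    have h1 : (Subobject.pullback U.arrow).obj U = ⊤ := by
      rw [eq_top_iff, ← Subobject.pullback_top U.arrow]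
      exact le_of_inf_le.1 inf_le_left
    have h2 := isBot_pullback (isBot_pullback hU U.arrow) f V
    rw [h1, Subobject.pullback_top] at h2
    exact top_le_iff.1 h2
  have heq : ∀ {Z Y : C} (_ : Z ⟶ (U : C)) (g h : Z ⟶ Y), g = h := fun f g h => by
    have : IsIso (equalizer.ι g h) := (Subobject.isIso_iff_mk_eq_top _).2 (htop f _)
    exact eq_of_epi_equalizer
  refine ⟨IsInitial.ofUniqueHom (fun Y => ?_) (fun Y m => heq (𝟙 _) _ _)⟩
  have : Mono (prod.fst : (U : C) ⨯ Y ⟶ U) := ⟨fun g _ _ => heq (g ≫ prod.fst) _ _⟩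
  have : IsIso (prod.fst : (U : C) ⨯ Y ⟶ U) :=
    (Subobject.isIso_iff_mk_eq_top _).2 (htop (𝟙 _) _)
  exact inv (prod.fst : (U : C) ⨯ Y ⟶ U) ≫ prod.snd

theorem nonempty_isInitial_iff_isBot {X : C} {U : Subobject X} :
    Nonempty (IsInitial (U : C)) ↔ IsBot U := by
  refine ⟨fun ⟨h⟩ V => ?_, nonempty_isInitial_of_isBot⟩
  exact Subobject.le_of_comm (h.to V) (h.hom_ext _ _)

theorem isBot_exists {X Y : C} (f : X ⟶ Y) {S : Subobject X} (hS : IsBot S) :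
    IsBot ((Subobject.exists f).obj S) := fun _ =>
  (((Subobject.existsPullbackAdj f).homEquiv _ _).symm (hS _).hom).le

end Coherent

/-! ### Sections satisfying a formula -/

section Truth

variable {C : Type u} [Category.{v} C] {D : Type u₂} [Category.{v₂} D]
  {J : GrothendieckTopology D} (M : C ⥤ Sheaf J (Type w))

/-- The subpresheaf `M U ⊆ M X` of sections satisfying the formula `U ↪ X`. -/
noncomputable def truth {X : C} (U : Subobject X) : Subfunctor (M.obj X).obj :=
  Subfunctor.range (M.map U.arrow).hom

theorem sections_mapSub [M.PreservesMonomorphisms] {X : C} (U : Subobject X) :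
    sections (mapSub M U) = truth M U :=
  sections_mk _

variable {M}

theorem truth_mono {X : C} {U V : Subobject X} (h : U ≤ V) : truth M U ≤ truth M V := by
  rw [truth, ← Subobject.ofLE_arrow h, M.map_comp]
  exact Subfunctor.range_comp_le _ _

theorem map_mem_truth_of_comp_eq {X Y Z : C} {U : Subobject X} (f : Y ⟶ X) (g : Z ⟶ Y)
    (h : U.Factors (g ≫ f)) {d : D} (z : (M.obj Z).obj.obj (op d)) :
    (M.map f).hom.app (op d) ((M.map g).hom.app (op d) z) ∈ (truth M U).obj (op d) := by
  refine ⟨(M.map (U.factorThru _ h)).hom.app (op d) z, ?_⟩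
  have e : M.map (U.factorThru _ h) ≫ M.map U.arrow = M.map g ≫ M.map f := by
    rw [← M.map_comp, ← M.map_comp, U.factorThru_arrow]
  exact congrArg (fun k : M.obj Z ⟶ M.obj X => k.hom.app (op d) z) e

theorem map_mem_truth_mk {X Y : C} (i : X ⟶ Y) [Mono i] {d : D}
    (x : (M.obj X).obj.obj (op d)) :
    (M.map i).hom.app (op d) x ∈ (truth M (Subobject.mk i)).obj (op d) := by
  have := map_mem_truth_of_comp_eq (U := Subobject.mk i) i (𝟙 X)
    (by rw [Category.id_comp]; exact Subobject.mk_factors_self i) x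
  rwa [M.map_id] at this

theorem mem_truth_top {X : C} {d : D}
    (x : (M.obj X).obj.obj (op d)) : x ∈ (truth M (⊤ : Subobject X)).obj (op d) := by
  have := map_mem_truth_mk (M := M) (𝟙 X) x
  rwa [M.map_id, ← Subobject.top_eq_id] at this

theorem sections_isSheaf_truth [M.PreservesMonomorphisms] {X : C} (U : Subobject X) :
    Presieve.IsSheaf J (truth M U).toFunctor := by
  rw [← sections_mapSub]
  exact sections_isSheaf _

variable [HasPullbacks C] [PreservesFiniteLimits M]

theorem map_mem_truth_iff {X Y : C} (f : Y ⟶ X) {U : Subobject X} {d : D}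
    {y : (M.obj Y).obj.obj (op d)} :
    (M.map f).hom.app (op d) y ∈ (truth M U).obj (op d) ↔
      y ∈ (truth M ((Subobject.pullback f).obj U)).obj (op d) := by
  constructor
  · rintro ⟨u, hu⟩
    let F : C ⥤ Type w := M ⋙ sheafToPresheaf J (Type w) ⋙ (evaluation Dᵒᵖ (Type w)).obj (op d)
    obtain ⟨z, -, hz⟩ := Types.exists_of_isPullback ((Subobject.isPullback f U).map F) u y hu
    exact ⟨z, hz⟩
  · rintro ⟨z, rfl⟩
    refine map_mem_truth_of_comp_eq f _ ?_ z
    rw [← (Subobject.isPullback f U).w]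
    exact Subobject.factors_comp_arrow _

theorem map_mem_truth_exists [HasImages C] {X Y : C} (f : Y ⟶ X) {V : Subobject Y} {d : D}
    {y : (M.obj Y).obj.obj (op d)} (hy : y ∈ (truth M V).obj (op d)) :
    (M.map f).hom.app (op d) y ∈ (truth M ((Subobject.exists f).obj V)).obj (op d) :=
  (map_mem_truth_iff f).2
    (truth_mono ((Subobject.existsPullbackAdj f).homEquiv _ _ (𝟙 _)).le _ hy)

theorem mem_truth_inf {X : C} {U V : Subobject X} {d : D} {x : (M.obj X).obj.obj (op d)}
    (hU : x ∈ (truth M U).obj (op d)) (hV : x ∈ (truth M V).obj (op d)) :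
    x ∈ (truth M (U ⊓ V)).obj (op d) := by
  obtain ⟨u, rfl⟩ := hU
  obtain ⟨z, rfl⟩ := (map_mem_truth_iff U.arrow).1 hV
  refine map_mem_truth_of_comp_eq U.arrow _ ?_ z
  rw [Subobject.inf_factors]
  refine ⟨Subobject.factors_comp_arrow _, ?_⟩
  rw [← (Subobject.isPullback U.arrow V).w]
  exact Subobject.factors_comp_arrow _

end Truth

section Unions

variable {C : Type u} [Category.{v} C] {D : Type u₂} [Category.{v₂} D]
  {J : GrothendieckTopology D} {M : C ⥤ Sheaf J (Type w)}

/-- A section in the value of `M` at a `κ`-small union locally belongs to one of its members. -/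
theorem sieveOfSection_iSup_truth_mem {κ : Cardinal.{v₂}} (hM : IsKCoherentFunctor κ M) {X : C}
    {ι : Type v₂} (hι : #ι < κ) {U : ι → Subobject X} {S : Subobject X}
    (hS : IsLUB (Set.range U) S) {d : D} {x : (M.obj X).obj.obj (op d)}
    (hx : x ∈ (truth M S).obj (op d)) :
    (⨆ i, truth M (U i)).sieveOfSection x ∈ J d := by
  have h := mem_sections_of_isLUB (hM.preservesUnions ι hι U S hS) (d := d) (x := x)
    (by rwa [sections_mapSub])
  simpa only [iSup_range, sections_mapSub] using h

theorem isStronglyPositivelyClosed_iff [IsCoherent C] [M.PreservesMonomorphisms] :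
    IsStronglyPositivelyClosed M ↔ ∀ ⦃X : C⦄ (U : Subobject X) ⦃d : D⦄
      (x : (M.obj X).obj.obj (op d)), ∃ S ∈ J d, ∀ ⦃c : D⦄ (f : c ⟶ d), S f →
        ∃ V : Subobject X, (V = U ∨ IsBot (V ⊓ U)) ∧
          (M.obj X).obj.map f.op x ∈ (truth M V).obj (op c) := by
  have htop : ∀ X : C, sections (⊤ : Subobject (M.obj X)) = ⊤ := fun X => by
    rw [Subobject.top_eq_id, sections_mk]
    exact Subfunctor.range_id _
  refine forall_congr' fun X => forall_congr' fun U => ?_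
  rw [isLUB_iff_sections, htop]
  constructor
  · intro h d x
    have hx : x ∈ (⊤ : Subfunctor (M.obj X).obj).obj (op d) := trivial
    rw [h] at hx
    refine ⟨_, hx, fun c f hf => ?_⟩
    simp only [Subfunctor.sieveOfSection_apply, Subfunctor.iSup_obj, Set.mem_iUnion] at hf
    obtain ⟨W, hW, hf⟩ := hf
    obtain rfl | ⟨V, hV, rfl⟩ := hW
    · rw [sections_mapSub] at hf
      exact ⟨U, Or.inl rfl, hf⟩
    · rw [sections_mapSub] at hf
      exact ⟨V, Or.inr (nonempty_isInitial_iff_isBot.1 hV), hf⟩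
  · intro h
    refine (top_le_iff.1 fun d x _ => ?_).symm
    obtain ⟨S, hS, hS'⟩ := h (d := unop d) x
    refine J.superset_covering (fun c f hf => ?_) hS
    obtain ⟨V, hV, hf⟩ := hS' f hf
    simp only [Subfunctor.sieveOfSection_apply, Subfunctor.iSup_obj, Set.mem_iUnion]
    rw [← sections_mapSub] at hf
    refine ⟨mapSub M V, ?_, hf⟩
    rcases hV with rfl | hV
    · exact Or.inl rfl
    · exact Or.inr ⟨V, nonempty_isInitial_iff_isBot.2 hV, rfl⟩

end Unions

/-! ### Truth values of closed formulas -/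

section TruthValues

variable {κ : Cardinal.{u}} {B : Type u} [BooleanAlgebra B] {C : Type u} [SmallCategory C]
  {M : C ⥤ Sheaf (unionTopology κ B) (Type u)}

/-- The restriction of a global section of `M X` to `b`. -/
def restrict {X : C} (a : (globalSections M).obj X) (b : B) : (M.obj X).obj.obj (op b) :=
  (M.obj X).obj.map (homOfLE le_top : b ⟶ ⊤).op a

/-- Restriction maps of presheaves on a preorder compose to any other parallel one. -/
theorem map_map_of_preorder {P : Type*} [Preorder P] (F : Pᵒᵖ ⥤ Type w) {p q r : Pᵒᵖ}
    (f : p ⟶ q) (g : q ⟶ r) (h : p ⟶ r) (x : F.obj p) : F.map g (F.map f x) = F.map h x := by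
  rw [Subsingleton.elim h (f ≫ g), Functor.map_comp, comp_apply]

theorem map_restrict {X : C} (a : (globalSections M).obj X) {b c : B} (f : c ⟶ b) :
    (M.obj X).obj.map f.op (restrict a b) = restrict a c :=
  map_map_of_preorder _ _ _ _ _

theorem restrict_top {X : C} (a : (globalSections M).obj X) : restrict a ⊤ = a :=
  congrArg (fun k : (M.obj X).obj.obj (op ⊤) ⟶ (M.obj X).obj.obj (op ⊤) => k a)
    ((M.obj X).obj.map_id (op ⊤))

theorem restrict_map {X Y : C} (f : X ⟶ Y) (a : (globalSections M).obj X) (b : B) :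
    restrict ((globalSections M).map f a) b = (M.map f).hom.app (op b) (restrict a b) :=
  (NatTrans.naturality_apply (M.map f).hom (homOfLE le_top : b ⟶ ⊤).op a).symm

/-- The elements `b` of `B` over which the global section `a` of `M X` satisfies `U ↪ X`. -/
def truthSet {X : C} (a : (globalSections M).obj X) (U : Subobject X) : Set B :=
  {b | restrict a b ∈ (truth M U).obj (op b)}

theorem truthSet_mono {X : C} (a : (globalSections M).obj X) {U V : Subobject X} (h : U ≤ V) :
    truthSet a U ⊆ truthSet a V :=
  fun _ hb => truth_mono h _ hb

theorem isLowerSet_truthSet {X : C} (a : (globalSections M).obj X) (U : Subobject X) :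
    IsLowerSet (truthSet a U) :=
  fun b c h hb => by
    have h' := (truth M U).map (homOfLE h).op hb
    rwa [Set.mem_preimage, map_restrict] at h'

theorem mem_truthSet_of_isLUB (hM : IsKCoherentFunctor κ M) {X : C}
    {a : (globalSections M).obj X} {U : Subobject X} {ι : Type u} (hι : #ι < κ) {f : ι → B}
    {b : B} (hb : IsLUB (Set.range f) b) (h : ∀ i, f i ∈ truthSet a U) : b ∈ truthSet a U := by
  refine ((truth M U).isSheaf_iff
    ((isSheaf_iff_isSheaf_of_type _ _).1 (M.obj X).property)).1 (sections_isSheaf_truth U) (op b) _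
    (mem_unionTopology hι f (fun i => ⟨homOfLE (hb.1 ⟨i, rfl⟩), ?_⟩) hb)
  rw [Subfunctor.sieveOfSection_apply, map_restrict]
  exact h i

theorem eq_bot_of_mem_truthSet (hκ : IsWeaklyCompact κ) (hM : IsKCoherentFunctor κ M) {X : C}
    {a : (globalSections M).obj X} {U : Subobject X} (hU : IsBot U) {b : B}
    (hb : b ∈ truthSet a U) : b = ⊥ := by
  refine eq_bot_of_bot_mem_unionTopology hκ ?_
  have := sieveOfSection_iSup_truth_mem hM (ι := PEmpty) (U := PEmpty.elim)
    (by simpa using aleph0_pos.trans_le hκ.1) (by rwa [Set.range_eq_empty, isLUB_empty_iff]) hb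
  refine (unionTopology κ B).superset_covering (fun c f hf => ?_) this
  simp at hf

/-- In a strongly positively closed model every formula `U` has a truth value `b`, and some
formula disjoint from `U` holds over `bᶜ`: the union of those members of a small cover over which
`U` holds is `b`, and the union of the formulas holding over the other members is still disjoint
from `U`. -/
theorem exists_truthValue [IsCoherent C] (hκ : IsWeaklyCompact κ) (hB : IsKCoherent κ B)
    (hC : HasStableUnions κ C) (hM : IsKCoherentFunctor κ M)
    (h : IsStronglyPositivelyClosed M) {X : C} (a : (globalSections M).obj X)
    (U : Subobject X) :
    ∃ (b : B) (V : Subobject X), IsBot (V ⊓ U) ∧ b ∈ truthSet a U ∧ bᶜ ∈ truthSet a V := by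
  obtain ⟨S, hS, hSV⟩ := isStronglyPositivelyClosed_iff.1 h U (d := (⊤ : B)) a
  obtain ⟨ι, hι, f, hf, hlub⟩ := exists_small_cover hκ hS
  obtain ⟨S₀, hS₀⟩ := exists_bot X
  have hS₀ : IsBot S₀ := by simpa only [Subobject.pullback_id] using hS₀ (𝟙 X)
  have hV : ∀ i, ∃ V : Subobject X, IsBot (V ⊓ U) ∧ (f i ∉ truthSet a U → f i ∈ truthSet a V) :=
    fun i => by
      obtain ⟨k, hk⟩ := hf i
      obtain ⟨V, rfl | hV, hVf⟩ := hSV k hk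
      · exact ⟨S₀, fun T => inf_le_left.trans (hS₀ T), fun h => (h hVf).elim⟩
      · exact ⟨V, hV, fun _ => hVf⟩
  choose V hV hfV using hV
  obtain ⟨W, hW, hWst⟩ := hC ι hι V
  obtain ⟨b, hb⟩ := hB.exists_isLUB_range (ι := {i // f i ∈ truthSet a U})
    ((mk_subtype_le _).trans_lt hι) (fun i => f i)
  refine ⟨b, W, fun T => ?_, ?_, ?_⟩
  · rw [inf_comm, le_of_inf_le]
    refine (hWst U.arrow).2 ?_
    rintro _ ⟨i, rfl⟩
    rw [← le_of_inf_le, inf_comm]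
    exact hV i T
  · exact mem_truthSet_of_isLUB hM ((mk_subtype_le _).trans_lt hι) hb fun i => i.2
  · have hbc := isLUB_range_inf hlub bᶜ
    rw [top_inf_eq] at hbc
    refine mem_truthSet_of_isLUB hM hι hbc fun i => ?_
    by_cases hi : f i ∈ truthSet a U
    · have h0 : f i ⊓ bᶜ ≤ f i ⊓ ⊥ := by
        rw [inf_bot_eq, ← inf_compl_self b]
        exact inf_le_inf_right _ (hb.1 ⟨⟨i, hi⟩, rfl⟩)
      -- Over the least element of `B` every formula holds, as the empty family covers it.
      exact isLowerSet_truthSet a W (h0.trans inf_le_right) (mem_truthSet_of_isLUB hM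
        (ι := PEmpty) (by simpa using aleph0_pos.trans_le hκ.1) (f := PEmpty.elim)
        (by rw [Set.range_eq_empty]; exact isLUB_empty) fun i => i.elim)
    · exact isLowerSet_truthSet a W inf_le_left
        (truthSet_mono a (hW.1 ⟨i, rfl⟩) (hfV i hi))

variable [PreservesFiniteLimits M]

theorem truthSet_pullback [HasPullbacks C] {X Y : C} (f : X ⟶ Y) (a : (globalSections M).obj X)
    (U : Subobject Y) :
    truthSet a ((Subobject.pullback f).obj U) = truthSet ((globalSections M).map f a) U := by
  ext b
  refine (map_mem_truth_iff f).symm.trans (iff_of_eq ?_)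
  rw [← restrict_map]
  rfl

theorem mem_truthSet_inf [HasPullbacks C] {X : C} {a : (globalSections M).obj X} {U V : Subobject X} {b : B}
    (hU : b ∈ truthSet a U) (hV : b ∈ truthSet a V) : b ∈ truthSet a (U ⊓ V) :=
  mem_truth_inf hU hV

variable [IsCoherent C]

theorem truthSet_subset_of_mk_le {X Y : C} {a : (globalSections M).obj X}
    {b : (globalSections M).obj Y} {U : Subobject X} {V : Subobject Y}
    (h : L1.mk a U ≤ L1.mk b V) : truthSet a U ⊆ truthSet b V := by
  obtain ⟨Z, c, f, g, rfl, rfl, h'⟩ := L1.mk_le_mk.1 h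
  rw [← truthSet_pullback, ← truthSet_pullback]
  exact truthSet_mono c h'

/-- A formula true everywhere is the top element of `L¹`: the parameter lifts to it. -/
theorem mk_eq_top_of_top_mem_truthSet {X : C} {a : (globalSections M).obj X} {U : Subobject X}
    (h : ⊤ ∈ truthSet a U) : L1.mk a U = ⊤ := by
  obtain ⟨u, hu⟩ : ∃ u : (globalSections M).obj (U : C), (globalSections M).map U.arrow u = a := by
    obtain ⟨u, hu⟩ := h
    exact ⟨u, hu.trans (restrict_top a)⟩
  rw [← hu, ← L1.mk_pullback, ← isTop_iff_eq_top]
  have : (Subobject.pullback U.arrow).obj U = ⊤ := by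
    rw [eq_top_iff, ← Subobject.pullback_top U.arrow]
    exact le_of_inf_le.1 inf_le_left
  rw [this]
  exact L1.isTop_mk u

/-- If `a` satisfies `U` over `b` and a formula disjoint from `U` over `bᶜ`, then `b` is the
truth value of `U` at `a`. -/
theorem truthSet_eq_Iic (hκ : IsWeaklyCompact κ) (hM : IsKCoherentFunctor κ M) {X : C}
    {a : (globalSections M).obj X} {U V : Subobject X} (hUV : IsBot (V ⊓ U)) {b : B}
    (hb : b ∈ truthSet a U) (hb' : bᶜ ∈ truthSet a V) : truthSet a U = Set.Iic b := by
  ext c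
  refine ⟨fun hc => ?_, fun hc => isLowerSet_truthSet a U hc hb⟩
  have h := eq_bot_of_mem_truthSet hκ hM hUV
    (mem_truthSet_inf (isLowerSet_truthSet a V (inf_le_right (a := c)) hb')
      (isLowerSet_truthSet a U (inf_le_left (b := bᶜ)) hc))
  exact disjoint_compl_right_iff.1 (disjoint_iff.2 h)

end TruthValues

/-! ### Binary coproducts -/

theorem HasSmallDisjointCoproducts.exists_binary {κ : Cardinal.{w}} (hκ : ℵ₀ ≤ κ) {C : Type u}
    [Category.{v} C] [HasPullbacks C] (hC : HasSmallDisjointCoproducts κ C) (X Y : C) :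
    ∃ (T : C) (i : X ⟶ T) (j : Y ⟶ T) (_ : Mono i) (_ : Mono j),
      IsBot (Subobject.mk i ⊓ Subobject.mk j) := by
  obtain ⟨h1, h2⟩ := hC (ULift.{w} Bool) (lt_of_lt_of_le (by simp) hκ)
  let Z : ULift.{w} Bool → C := fun b => cond b.down X Y
  have hZ : CoproductDisjoint Z := h2.coproductDisjoint Z
  let i : X ⟶ ∐ Z := Sigma.ι Z ⟨true⟩
  let j : Y ⟶ ∐ Z := Sigma.ι Z ⟨false⟩
  have hi : Mono i := inferInstanceAs (Mono (Sigma.ι Z ⟨true⟩))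
  have hj : Mono j := inferInstanceAs (Mono (Sigma.ι Z ⟨false⟩))
  refine ⟨∐ Z, i, j, hi, hj, fun V => ?_⟩
  have hI : IsInitial (pullback i j) :=
    IsInitial.ofCoproductDisjoint (X := Z) (i := ⟨true⟩) (j := ⟨false⟩) (by simp)
  have hf := (Subobject.inf_factors
    (Subobject.mk i ⊓ Subobject.mk j).arrow).1 (Subobject.factors_self _)
  obtain ⟨p, hp⟩ : ∃ p : _ ⟶ X, p ≫ i = (Subobject.mk i ⊓ Subobject.mk j).arrow :=
    (Subobject.mk_factors_iff i _).1 hf.1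
  obtain ⟨q, hq⟩ : ∃ q : _ ⟶ Y, q ≫ j = (Subobject.mk i ⊓ Subobject.mk j).arrow :=
    (Subobject.mk_factors_iff j _).1 hf.2
  refine Subobject.le_of_comm (pullback.lift p q (hp.trans hq.symm) ≫ hI.to V) ?_
  rw [Category.assoc, hI.hom_ext (hI.to V ≫ V.arrow) (pullback.fst i j ≫ i),
    pullback.lift_fst_assoc]
  exact hp

section LindenbaumTarski

variable {κ : Cardinal.{u}} {B : Type u} [BooleanAlgebra B] {C : Type u} [SmallCategory C]
  {M : C ⥤ Sheaf (unionTopology κ B) (Type u)} [IsCoherent C] [PreservesFiniteLimits M]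

/-! ### Strongly positively closed models -/

/-- Truth values identify `L¹(Γ M)` with `B` when `M` is strongly positively closed. They
are onto because `1 + 1` has a global section lying in the first summand exactly over `b`. -/
theorem nonempty_orderIso_of_isStronglyPositivelyClosed (hκ : IsWeaklyCompact κ)
    (hB : IsKCoherent κ B) (hC : HasStableUnions κ C) (hC' : HasSmallDisjointCoproducts κ C)
    (hM : IsKCoherentFunctor κ M) (h : IsStronglyPositivelyClosed M) :
    Nonempty (L1 (globalSections M) ≃o B) := by
  have hval : ∀ t : L1 (globalSections M), ∃ b : B, ∀ ⦃X : C⦄ (a : (globalSections M).obj X)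
      (U : Subobject X), t = L1.mk a U → truthSet a U = Set.Iic b := fun t => by
    obtain ⟨X, a, U, rfl⟩ := L1.ind t
    obtain ⟨b, V, hUV, hb, hb'⟩ := exists_truthValue hκ hB hC hM h a U
    refine ⟨b, fun Y c W e => ?_⟩
    rw [← truthSet_eq_Iic hκ hM hUV hb hb']
    exact (truthSet_subset_of_mk_le e.ge).antisymm (truthSet_subset_of_mk_le e.le)
  choose e he using hval
  have hle : ∀ s t, e s ≤ e t ↔ s ≤ t := fun s t => by
    obtain ⟨X, a, U, V, rfl, rfl⟩ := L1.exists_common s t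
    rw [← Set.Iic_subset_Iic, ← he _ a U rfl, ← he _ a V rfl]
    refine ⟨fun hUV => ?_, truthSet_subset_of_mk_le⟩
    obtain ⟨b, U', hU', hb, hb'⟩ := exists_truthValue hκ hB hC hM h a U
    -- The formula `U' ∪ V` holds over `bᶜ` and over `b`, hence everywhere.
    have htop : L1.mk a U' ⊔ L1.mk a V = ⊤ := by
      rw [← L1.mk_sup]
      apply mk_eq_top_of_top_mem_truthSet
      have hbV := hUV hb
      refine mem_truthSet_of_isLUB hM (ι := ULift.{u} Bool) (lt_of_lt_of_le (by simp) hκ.1)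
        (f := fun i => cond i.down b bᶜ) ⟨fun _ _ => le_top, fun c hc => ?_⟩ ?_
      · rw [← sup_compl_eq_top (x := b)]
        exact sup_le (hc ⟨⟨true⟩, rfl⟩) (hc ⟨⟨false⟩, rfl⟩)
      · rintro ⟨_ | _⟩
        · exact truthSet_mono a ((subobjectDistribLattice X).le_sup_left U' V) hb'
        · exact truthSet_mono a ((subobjectDistribLattice X).le_sup_right U' V) hbV
    have hbot : L1.mk a U ⊓ L1.mk a U' = ⊥ := by
      rw [inf_comm, ← L1.mk_inf]
      exact isBot_iff_eq_bot.1 (L1.isBot_mk a hU')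
    calc L1.mk a U = L1.mk a U ⊓ (L1.mk a U' ⊔ L1.mk a V) := by rw [htop, inf_top_eq]
      _ = L1.mk a U ⊓ L1.mk a V := by rw [inf_sup_left, hbot, bot_sup_eq]
      _ ≤ L1.mk a V := inf_le_right
  have hsurj : Function.Surjective e := fun b => by
    obtain ⟨T, i, j, _, _, hij⟩ := hC'.exists_binary hκ.1 (⊤_ C) (⊤_ C)
    obtain ⟨p⟩ := Formula.exists_terminal (F := globalSections M)
    obtain ⟨s, hs1, hs2⟩ := exists_glue hκ.1 (M.obj T) b
      ((M.map i).hom.app (op b) (restrict p b)) ((M.map j).hom.app (op bᶜ) (restrict p bᶜ))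
    refine ⟨L1.mk (X := T) s (Subobject.mk i), ?_⟩
    rw [← Set.Iic_inj, ← he _ (X := T) s (Subobject.mk i) rfl]
    refine truthSet_eq_Iic hκ hM (V := Subobject.mk j) (by rwa [inf_comm]) ?_ ?_
    · change restrict (X := T) s b ∈ (truth M (Subobject.mk i)).obj (op b)
      rw [show restrict (X := T) s b = _ from hs1]
      exact map_mem_truth_mk i _
    · change restrict (X := T) s bᶜ ∈ (truth M (Subobject.mk j)).obj (op bᶜ)
      rw [show restrict (X := T) s bᶜ = _ from hs2]
      exact map_mem_truth_mk j _
  exact ⟨RelIso.ofSurjective (OrderEmbedding.ofMapLEIff e hle) hsurj⟩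

/-! ### Complemented Lindenbaum-Tarski lattices -/

/-- A complement of a closed formula, read in a common refinement `f : Z ⟶ X` of the two
formulas. -/
theorem exists_refinement_of_complementedLattice
    [ComplementedLattice (L1 (globalSections M))] {X : C} (a : (globalSections M).obj X)
    (U : Subobject X) :
    ∃ (Z : C) (c : (globalSections M).obj Z) (f : Z ⟶ X) (V : Subobject Z),
      (globalSections M).map f c = a ∧ IsBot (V ⊓ (Subobject.pullback f).obj U) ∧
      ∃ S : Subobject Z, IsLUB {(Subobject.pullback f).obj U, V} S ∧ L1.mk c S = ⊤ := by
  obtain ⟨t, ht⟩ := exists_isCompl (L1.mk a U)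
  obtain ⟨Y, b, W, rfl⟩ := L1.ind t
  obtain ⟨Z, c, p, q, rfl, rfl⟩ := Formula.exists_prod X Y a b
  obtain ⟨S₀, hS₀⟩ := exists_bot Z
  have hS₀ : IsBot S₀ := by simpa only [Subobject.pullback_id] using hS₀ (𝟙 Z)
  rw [← L1.mk_pullback, ← L1.mk_pullback] at ht
  have hinf := ht.inf_eq_bot
  rw [← L1.mk_inf, ← isBot_iff_eq_bot] at hinf
  obtain ⟨Z', c', g, rfl, hg⟩ := L1.mk_le_mk_iff.1 (hinf (L1.mk c S₀))
  refine ⟨Z', c', g ≫ p, (Subobject.pullback g).obj ((Subobject.pullback q).obj W),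
    by simp, fun T => ?_, ?_⟩
  · rw [Subobject.pullback_comp, inf_comm, ← Subobject.inf_pullback]
    exact hg.trans (isBot_pullback hS₀ g T)
  · obtain ⟨S, hS, -⟩ := exists_sup ((Subobject.pullback (g ≫ p)).obj U)
      ((Subobject.pullback g).obj ((Subobject.pullback q).obj W))
    refine ⟨S, hS, ?_⟩
    rw [(L1.isLUB_mk c' hS).unique isLUB_pair, Subobject.pullback_comp, L1.mk_pullback,
      L1.mk_pullback (f := g)]
    exact ht.sup_eq_top

/-- Given a section `x` of `M X` over `b`, extend it to a global section of `M (X + 1)` by the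
point of the second summand over `bᶜ`. The complement of `U` at this section, realized over
some `f : Z ⟶ X + 1`, has an image in `X + 1` that is disjoint from `U` by Frobenius
reciprocity; its trace on `X` is the required subobject. -/
theorem isStronglyPositivelyClosed_of_complementedLattice (hκ : IsWeaklyCompact κ)
    (hC' : HasSmallDisjointCoproducts κ C) (hM : IsKCoherentFunctor κ M)
    [ComplementedLattice (L1 (globalSections M))] : IsStronglyPositivelyClosed M := by
  rw [isStronglyPositivelyClosed_iff]
  intro X U b x
  obtain ⟨T, i, j, _, _, -⟩ := hC'.exists_binary hκ.1 X (⊤_ C)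
  obtain ⟨p⟩ := Formula.exists_terminal (F := globalSections M)
  obtain ⟨s, hs, -⟩ := exists_glue hκ.1 (M.obj T) b
    ((M.map i).hom.app (op b) x) ((M.map j).hom.app (op bᶜ) (restrict p bᶜ))
  obtain ⟨Z, c, f, V, hc, hV, S, hS, htop⟩ :=
    exists_refinement_of_complementedLattice (X := T) s ((Subobject.map i).obj U)
  set A := (Subobject.pullback f).obj ((Subobject.map i).obj U) with hA
  have hcS : ⊤ ∈ truthSet c S :=
    truthSet_subset_of_mk_le (le_top.trans htop.ge) (mem_truth_top (restrict c ⊤))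
  have hcov := sieveOfSection_iSup_truth_mem hM (ι := ULift.{u} Bool)
    (U := fun k => cond k.down A V) (lt_of_lt_of_le (by simp) hκ.1) (S := S)
    (by
      convert hS
      ext W
      simp [or_comm, eq_comm]) hcS
  refine ⟨_, (unionTopology κ B).pullback_stable (homOfLE le_top : b ⟶ ⊤) hcov, fun d g hg => ?_⟩
  -- The restriction of `s` to `d ≤ b` is the image of the restriction of `x`.
  have hsd : restrict (X := T) s d = (M.map i).hom.app (op d) ((M.obj X).obj.map g.op x) := by
    rw [← map_restrict (X := T) s g, show restrict (X := T) s b = _ from hs]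
    exact (NatTrans.naturality_apply (M.map i).hom g.op x).symm
  have hcd : restrict (X := T) s d = (M.map f).hom.app (op d) (restrict c d) := by
    rw [← restrict_map, hc]
  have key : ∀ W : Subobject T, restrict (X := T) s d ∈ (truth M W).obj (op d) →
      (M.obj X).obj.map g.op x ∈ (truth M ((Subobject.pullback i).obj W)).obj (op d) :=
    fun W hW => by
      rw [hsd] at hW
      exact (map_mem_truth_iff i).1 hW
  simp only [Sieve.pullback_apply, Subfunctor.sieveOfSection_apply, Subfunctor.iSup_obj,
    Set.mem_iUnion] at hg
  obtain ⟨⟨k⟩, hk⟩ := hg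
  replace hk : restrict c d ∈ (truth M (cond k A V)).obj (op d) := by
    rwa [map_restrict] at hk
  cases k with
  | true =>
    refine ⟨U, Or.inl rfl, ?_⟩
    rw [← Subobject.pullback_map_self i U]
    apply key
    rw [hcd]
    exact (map_mem_truth_iff f).2 hk
  | false =>
    refine ⟨(Subobject.pullback i).obj ((Subobject.exists f).obj V), Or.inr ?_, ?_⟩
    · have h0 := isBot_pullback (isBot_exists f hV) i
      rwa [Regular.exists_inf_pullback_eq_exists_inf, Subobject.inf_pullback,
        Subobject.pullback_map_self] at h0
    · apply key
      rw [hcd]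
      exact map_mem_truth_exists f hk

end LindenbaumTarski

end KCoh

theorem mainTheorem3 (κ : Cardinal.{u}) (hκ : KCoh.IsWeaklyCompact κ)
    (B : Type u) [BooleanAlgebra B] (hB : KCoh.IsKCoherent κ B)
    (C : Type u) [SmallCategory C] (hC : KCoh.IsKCoherent κ C)
    (hC' : KCoh.HasSmallDisjointCoproducts κ C)
    (M : C ⥤ Sheaf (KCoh.unionTopology κ B) (Type u)) (hM : KCoh.IsKCoherentFunctor κ M) :
    haveI : KCoh.IsCoherent C := hC.isCoherent hκ.1
    haveI : PreservesFiniteLimits M := hM.preservesFiniteLimits hκ.1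
    List.TFAE
      [KCoh.IsStronglyPositivelyClosed M,
        ComplementedLattice (KCoh.L1 (KCoh.globalSections M)),
        Nonempty (KCoh.L1 (KCoh.globalSections M) ≃o B)] := by
  have : KCoh.IsCoherent C := hC.isCoherent hκ.1
  have : PreservesFiniteLimits M := hM.preservesFiniteLimits hκ.1
  tfae_have 1 → 3 :=
    KCoh.nonempty_orderIso_of_isStronglyPositivelyClosed hκ hB hC.hasStableUnions hC' hM
  tfae_have 3 → 2 := fun ⟨e⟩ => e.complementedLattice_iff.2 inferInstance
  tfae_have 2 → 1 := fun _ =>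
    KCoh.isStronglyPositivelyClosed_of_complementedLattice hκ hC' hM
  tfae_finish
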